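/- For complex $a,q$ and $n\in\mathbb Z_{\ge 0}$ let $(a;q)_n=\prod_{k=0}^{n-1}(1-aq^k)$ and, for $|q|<1$, $(a;q)_\infty=\lim_{n\to\infty}(a;q)_n$. For $0<|q|<1$ and $z\ne 0$ put $$Q(q,z)=(q;q)_\infty\,(-z;q)_\infty\,(-q/z;q)_\infty\,(q/z^2;q^2)_\infty\,(z^2q;q^2)_\infty .$$ Let $q$ be a complex number with $0<|q|<1$ and write $\tilde q=q^2$, $(\tilde q)_n=(\tilde q;\tilde q)_n$, $(\tilde q)_\infty=(\tilde q;\tilde q)_\infty$. Then for every integer $v\ge 1$, $$\sum_{n_1,\ldots,n_v\ge 0}\frac{\tilde q^{\,\sum_{i=1}^v N_i(N_i+1)}}{(\tilde q)_{n_1}\cdots(\tilde q)_{n_{v-1}}\,(\tilde q)_{2n_v+1}}\cdot\frac{(q^3;q^6)_{n_v}}{(q;q^2)_{n_v}}=\frac{Q(q^{12v+6},q^{4v+1})}{(\tilde q)_\infty},$$ where $N_i=n_i+n_{i+1}+\cdots+n_v$ and the series converges absolutely. In particular, for $v=1$ (item (124) on Slater's list of Rogers--Ramanujan type identities), $$\sum_{n\ge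 0}\frac{q^{2n(n+1)}}{(\tilde q)_{2n+1}}\cdot\frac{(q^3;q^6)_n}{(q;q^2)_n}=\frac{Q(q^{18},q^5)}{(\tilde q)_\infty}.$$ -/

import Mathlib

/-- The finite `q`-Pochhammer symbol `(a; q)_n = (1 - a)(1 - a q) ⋯ (1 - a q^(n-1))`. -/
noncomputable def qPoch (a q : ℂ) (n : ℕ) : ℂ :=
  ∏ k ∈ Finset.range n, (1 - a * q ^ k)

/-- The infinite `q`-Pochhammer symbol `(a; q)_∞ = ∏_{k ≥ 0} (1 - a q^k)`, for `|q| < 1`. -/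
noncomputable def qPochInf (a q : ℂ) : ℂ :=
  ∏' k : ℕ, (1 - a * q ^ k)

/-- For `|q| < 1`, `(a; q)_∞` is the limit of `(a; q)_n` as `n → ∞`. -/
theorem tendsto_qPoch (a q : ℂ) (hq : ‖q‖ < 1) :
    Filter.Tendsto (qPoch a q) Filter.atTop (nhds (qPochInf a q)) := by
  have h : Multipliable fun k : ℕ => 1 - a * q ^ k := by
    simp only [sub_eq_add_neg]
    apply multipliable_one_add_of_summable
    simp only [norm_neg, norm_mul, norm_pow]
    exact (summable_geometric_of_lt_one (norm_nonneg q) hq).mul_left _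
  exact h.hasProd.tendsto_prod_nat

/-- `Q(q, z) = (q, -z, -q/z; q)_∞ (q/z², z² q; q²)_∞`, the quintuple product. -/
noncomputable def quintQ (q z : ℂ) : ℂ :=
  (qPochInf q q * qPochInf (-z) q * qPochInf (-(q / z)) q) *
    (qPochInf (q / z ^ 2) (q ^ 2) * qPochInf (z ^ 2 * q) (q ^ 2))

/-- `N_i = n_i + n_{i+1} + ⋯ + n_v`, where the indices `1, …, v` are represented by `Fin v`. -/
def tailSum {v : ℕ} (n : Fin v → ℕ) (i : Fin v) : ℕ :=
  ∑ j ∈ Finset.Ici i, n j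

/-- The last index of `Fin v`, for `v ≥ 1`; it stands for the index `v` of `n_v`. -/
def lastIdx (v : ℕ) (hv : 1 ≤ v) : Fin v :=
  ⟨v - 1, Nat.sub_lt hv Nat.one_pos⟩

/-- The summand of the `v`-fold series, with `q̃ = q²`:
`q̃^(∑ N_i (N_i + 1)) / ((q̃; q̃)_{n_1} ⋯ (q̃; q̃)_{n_{v-1}} (q̃; q̃)_{2 n_v + 1})
  * (q³; q⁶)_{n_v} / (q; q²)_{n_v}`. -/
noncomputable def hierarchyTerm (q : ℂ) (v : ℕ) (hv : 1 ≤ v) (n : Fin v → ℕ) : ℂ :=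
  (q ^ 2) ^ (∑ i, tailSum n i * (tailSum n i + 1)) /
      ((∏ i ∈ Finset.Iio (lastIdx v hv), qPoch (q ^ 2) (q ^ 2) (n i)) *
        qPoch (q ^ 2) (q ^ 2) (2 * n (lastIdx v hv) + 1)) *
    (qPoch (q ^ 3) (q ^ 6) (n (lastIdx v hv)) / qPoch q (q ^ 2) (n (lastIdx v hv)))

open Filter Topology

/-! ### Reciprocal `q`-factorials -/

/-! Put p = q² and let ζ + ζ⁻¹ = 1, so ζ is a primitive sixth root of unity. Since 1 + y + y² = (1 +
ζy)(1 + ζ⁻¹y), the quotient (q³;q⁶)_n/(q;q²)_n is (-ζq;q²)_n(-q/ζ;q²)_n, which the finite Jacobi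
triple product expands. A combination of the expansions at ζ and ζ⁻¹ is a Bailey pair relative to p
with coefficients c_j = 1, 1, 0, -1, -1, 0 of period six (`isBaileyPair_sextic`).

Bailey's lemma multiplies A_r by p^(r(r+1)) at each step; v uses of it
(`IsBaileyPair.hasSum_baileyTerm`) turn the v-fold sum into Σ_j c_j q^(j² + 2v(j² + j)) over ℤ,
divided by (p;p)_∞. Split modulo 3, this is the series side of the quintuple product
(`hasSum_quintQ`).

Absolute convergence is part of `HasSum`, because unconditional and absolute convergence agree in ℂ.
-/

theorem qPoch_succ (a q : ℂ) (n : ℕ) : qPoch a q (n + 1) = qPoch a q n * (1 - a * q ^ n) :=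
  Finset.prod_range_succ _ _

theorem qPoch_zero (a q : ℂ) : qPoch a q 0 = 1 := rfl

theorem one_sub_pow_ne_zero {q : ℂ} (hq : ‖q‖ < 1) {n : ℕ} (hn : n ≠ 0) : 1 - q ^ n ≠ 0 := by
  intro h
  have h1 : ‖q ^ n‖ = 1 := by rw [← sub_eq_zero.mp h]; simp
  rw [norm_pow] at h1
  exact (pow_lt_one₀ (norm_nonneg q) hq hn).ne h1

theorem qPoch_self_ne_zero {p : ℂ} (hp : ‖p‖ < 1) (n : ℕ) : qPoch p p n ≠ 0 :=
  Finset.prod_ne_zero_iff.mpr fun k _ => by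
    rw [← pow_succ']; exact one_sub_pow_ne_zero hp k.succ_ne_zero

theorem qPochInf_self_ne_zero {p : ℂ} (hp : ‖p‖ < 1) : qPochInf p p ≠ 0 := by
  have h : ∀ k : ℕ, 1 + -(p * p ^ k) ≠ 0 := fun k => by
    rw [← pow_succ', ← sub_eq_add_neg]; exact one_sub_pow_ne_zero hp k.succ_ne_zero
  have := tprod_one_add_ne_zero_of_summable h (by
    simp only [norm_neg, norm_mul, norm_pow]
    exact (summable_geometric_of_lt_one (norm_nonneg p) hp).mul_left _)
  simpa only [qPochInf, sub_eq_add_neg] using this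

/-- The reciprocal `1 / (p; p)_i`, extended by `0` to negative `i`. -/
noncomputable def recipPoch (p : ℂ) (i : ℤ) : ℂ := if 0 ≤ i then (qPoch p p i.toNat)⁻¹ else 0

theorem recipPoch_natCast (p : ℂ) (n : ℕ) : recipPoch p n = (qPoch p p n)⁻¹ := by
  simp [recipPoch]

theorem recipPoch_zero (p : ℂ) : recipPoch p 0 = 1 := by simp [recipPoch, qPoch_zero]

theorem recipPoch_of_neg (p : ℂ) {i : ℤ} (hi : i < 0) : recipPoch p i = 0 := if_neg hi.not_ge

/-- Extension by zero keeps the recurrence valid on all of ℤ: at i = 0 the factor 1 - p^i vanishes.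
Boundary terms in later sums then need no separate treatment. -/
theorem one_sub_zpow_mul_recipPoch {p : ℂ} (hp : ‖p‖ < 1) (i : ℤ) :
    (1 - p ^ i) * recipPoch p i = recipPoch p (i - 1) := by
  rcases lt_trichotomy i 0 with hi | rfl | hi
  · rw [recipPoch_of_neg p hi, recipPoch_of_neg p (by lia), mul_zero]
  · rw [recipPoch_of_neg p (i := 0 - 1) (by lia)]; simp
  · obtain ⟨n, rfl⟩ : ∃ n : ℕ, i = (n + 1 : ℕ) := ⟨(i - 1).toNat, by lia⟩
    have h := qPoch_self_ne_zero hp n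
    have h' := one_sub_pow_ne_zero hp n.succ_ne_zero
    rw [show ((n + 1 : ℕ) : ℤ) - 1 = n by simp, recipPoch_natCast, recipPoch_natCast, qPoch_succ,
      zpow_natCast, ← pow_succ']
    rw [Nat.succ_eq_add_one] at h'
    field_simp

theorem tendsto_recipPoch {p : ℂ} (hp : ‖p‖ < 1) :
    Tendsto (fun n : ℕ => recipPoch p n) atTop (𝓝 (qPochInf p p)⁻¹) := by
  simp only [recipPoch_natCast]
  exact (tendsto_qPoch p p hp).inv₀ (qPochInf_self_ne_zero hp)

theorem exists_norm_le_of_tendsto {u : ℕ → ℂ} {x : ℂ} (h : Tendsto u atTop (𝓝 x)) :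
    ∃ C : ℝ, 0 ≤ C ∧ ∀ n, ‖u n‖ ≤ C := by
  obtain ⟨C, hC⟩ := (Metric.isBounded_range_of_tendsto u h).exists_norm_le
  exact ⟨C, (norm_nonneg _).trans (hC _ ⟨0, rfl⟩), fun n => hC _ ⟨n, rfl⟩⟩

theorem exists_norm_recipPoch_le {p : ℂ} (hp : ‖p‖ < 1) :
    ∃ C : ℝ, 0 ≤ C ∧ ∀ i, ‖recipPoch p i‖ ≤ C := by
  obtain ⟨C, hC, h⟩ := exists_norm_le_of_tendsto (tendsto_recipPoch hp)
  refine ⟨C, hC, fun i => ?_⟩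
  rcases lt_or_ge i 0 with hi | hi
  · simpa [recipPoch_of_neg p hi]
  · lift i to ℕ using hi
    exact h i

theorem tendsto_recipPoch_comp {p : ℂ} (hp : ‖p‖ < 1) {f : ℕ → ℤ} (hf : Tendsto f atTop atTop) :
    Tendsto (fun n => recipPoch p (f n)) atTop (𝓝 (qPochInf p p)⁻¹) := by
  have h1 : Tendsto (fun n => (f n).toNat) atTop atTop := by
    refine tendsto_atTop.mpr fun b => (hf.eventually_ge_atTop (b : ℤ)).mono fun n hn => by lia
  refine ((tendsto_recipPoch hp).comp h1).congr' ?_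
  filter_upwards [hf.eventually_ge_atTop 0] with n hn
  simp [Int.toNat_of_nonneg hn]

/-- A limiting form of the `q`-Chu–Vandermonde summation. -/
theorem sum_recipPoch_vandermonde {p : ℂ} (hp : ‖p‖ < 1) (m b : ℕ) :
    ∑ t ∈ Finset.range (m + 1), p ^ (t * (t + b)) *
      (recipPoch p t * recipPoch p (m - t) * recipPoch p (t + b)) =
      recipPoch p m * recipPoch p (m + b) := by
  induction m generalizing b with
  | zero => simp [recipPoch_zero]
  | succ m ih =>
    have hne : (1 - p ^ (m + 1)) ≠ 0 := one_sub_pow_ne_zero hp m.succ_ne_zero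
    apply mul_left_cancel₀ hne
    -- A q-Pascal split: 1 - p^(m+1) = (1 - p^(m+1-t)) + p^(m+1-t)(1 - p^t). The first part gives
    -- the case (m, b), the second, after t = k + 1, the case (m, b + 1).
    have key : ∀ t ∈ Finset.range (m + 2), (1 - p ^ (m + 1)) * (p ^ (t * (t + b)) *
        (recipPoch p t * recipPoch p ((m + 1 : ℕ) - t) * recipPoch p (t + b))) =
        p ^ (t * (t + b)) * (recipPoch p t * recipPoch p (m - t) * recipPoch p (t + b)) +
        p ^ (t * (t + b) + (m + 1 - t)) *
          (recipPoch p (t - 1) * recipPoch p (m + 1 - t) * recipPoch p (t + b)) := by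
      intro t ht
      have ht' : t ≤ m + 1 := by simpa [Nat.lt_succ_iff] using ht
      have h1 := one_sub_zpow_mul_recipPoch hp (t : ℤ)
      have h2 := one_sub_zpow_mul_recipPoch hp ((m + 1 - t : ℕ) : ℤ)
      have h3 : p ^ (m + 1) = p ^ t * p ^ (m + 1 - t) := by
        rw [← pow_add]; congr 1; lia
      push_cast [ht'] at h2
      rw [zpow_natCast] at h1
      rw [show ((m : ℤ) + 1 - t) = ((m + 1 - t : ℕ) : ℤ) by lia, zpow_natCast,
        show (((m + 1 - t : ℕ) : ℤ)) - 1 = m - t by lia] at h2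
      rw [← h1, ← h2, h3, show (((m + 1 : ℕ) : ℤ) - t) = ((m + 1 - t : ℕ) : ℤ) by lia,
        show ((m : ℤ) + 1 - t) = ((m + 1 - t : ℕ) : ℤ) by lia, pow_add]
      ring
    rw [Finset.mul_sum, Finset.sum_congr rfl key, Finset.sum_add_distrib,
      Finset.sum_range_succ _ (m + 1), Finset.sum_range_succ' _ (m + 1), ih b]
    rw [recipPoch_of_neg p (i := (m : ℤ) - (m + 1 : ℕ)) (by push_cast; lia),
      recipPoch_of_neg p (i := ((0 : ℕ) : ℤ) - 1) (by norm_num)]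
    have h4 : ∑ k ∈ Finset.range (m + 1), p ^ ((k + 1) * (k + 1 + b) + (m + 1 - (k + 1))) *
        (recipPoch p ((k + 1 : ℕ) - 1) * recipPoch p (m + 1 - (k + 1 : ℕ)) *
          recipPoch p ((k + 1 : ℕ) + b)) =
        p ^ (m + b + 1) * (recipPoch p m * recipPoch p (m + (b + 1 : ℕ))) := by
      rw [← ih (b + 1), Finset.mul_sum]
      refine Finset.sum_congr rfl fun k hk => ?_
      have hk' : k ≤ m := by simpa [Nat.lt_succ_iff] using hk
      rw [← mul_assoc (p ^ (m + b + 1)), ← pow_add]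
      congr 2
      · obtain ⟨d, rfl⟩ := Nat.exists_eq_add_of_le hk'
        rw [show k + d + 1 - (k + 1) = d by lia]
        ring
      · congr 2 <;> push_cast <;> ring
      · push_cast; ring_nf
    rw [h4]
    have h5 := one_sub_zpow_mul_recipPoch hp ((m + 1 : ℕ) : ℤ)
    have h6 := one_sub_zpow_mul_recipPoch hp ((m + b + 1 : ℕ) : ℤ)
    rw [zpow_natCast] at h5 h6
    rw [← mul_assoc (1 - p ^ (m + 1)), h5]
    rw [show ((m + 1 : ℕ) : ℤ) - 1 = m by simp]
    rw [show ((m + b + 1 : ℕ) : ℤ) - 1 = m + b by push_cast; ring] at h6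
    rw [← h6, show ((m + 1 : ℕ) : ℤ) + b = (m + b + 1 : ℕ) by push_cast; ring,
      show (m : ℤ) + (b + 1 : ℕ) = (m + b + 1 : ℕ) by push_cast; ring]
    ring

/-! ### The Jacobi triple product -/

/-- A new factor 1 + x s^(2n+1) adds the series to its shift by one, and q-Pascal recombines the
terms. The value c at n = 0 is left free so that the induction can run twice: for x⁻¹ to build up m,
then, after j ↦ -j, for x to build up n. -/
theorem hasSum_finite_tripleProduct_aux {s x : ℂ} (hs0 : s ≠ 0) (hs : ‖s‖ < 1) (hx : x ≠ 0)
    (m n : ℕ) {c : ℂ}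
    (h : HasSum (fun j : ℤ => x ^ j * s ^ (j ^ 2) * (qPoch (s ^ 2) (s ^ 2) m *
      (recipPoch (s ^ 2) (-j) * recipPoch (s ^ 2) (m + j)))) c) :
    HasSum (fun j : ℤ => x ^ j * s ^ (j ^ 2) * (qPoch (s ^ 2) (s ^ 2) (m + n) *
      (recipPoch (s ^ 2) (n - j) * recipPoch (s ^ 2) (m + j)))) (c * qPoch (-(x * s)) (s ^ 2) n) := by
  have hp : ‖s ^ 2‖ < 1 := by rw [norm_pow]; exact pow_lt_one₀ (norm_nonneg s) hs two_ne_zero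
  induction n with
  | zero => simpa [qPoch_zero] using h
  | succ n ih =>
    have h2 := ((Equiv.subRight (1 : ℤ)).hasSum_iff.mpr ih).mul_left (x * s ^ (2 * n + 1))
    have h3 := ih.add h2
    rw [show c * qPoch (-(x * s)) (s ^ 2) (n + 1) = c * qPoch (-(x * s)) (s ^ 2) n +
      x * s ^ (2 * n + 1) * (c * qPoch (-(x * s)) (s ^ 2) n) by rw [qPoch_succ]; ring]
    convert h3 using 2 with j
    have e1 := one_sub_zpow_mul_recipPoch hp ((n + 1 : ℕ) - j)
    have e2 := one_sub_zpow_mul_recipPoch hp (m + j)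
    rw [show ((n + 1 : ℕ) : ℤ) - j - 1 = n - j by push_cast; ring] at e1
    have e3 : (s ^ 2) ^ (m + n + 1) =
        (s ^ 2) ^ ((m : ℤ) + j) * (s ^ 2) ^ (((n + 1 : ℕ) : ℤ) - j) := by
      rw [← zpow_add₀ (pow_ne_zero 2 hs0), ← zpow_natCast]; congr 1; push_cast; ring
    have e4 : x ^ (j - 1) * s ^ ((j - 1) ^ 2) * (x * s ^ (2 * n + 1)) =
        x ^ j * s ^ (j ^ 2) * (s ^ 2) ^ (((n + 1 : ℕ) : ℤ) - j) := by
      rw [zpow_sub_one₀ hx, ← zpow_natCast s 2, ← zpow_mul, ← zpow_natCast s (2 * n + 1)]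
      have : s ^ ((j - 1) ^ 2) * s ^ ((2 * n + 1 : ℕ) : ℤ) =
          s ^ (j ^ 2) * s ^ (((2 : ℕ) : ℤ) * ((n + 1 : ℕ) - j)) := by
        rw [← zpow_add₀ hs0, ← zpow_add₀ hs0]; congr 1; push_cast; ring
      rw [mul_assoc (x ^ j) (s ^ (j ^ 2)), ← this]
      field_simp
    simp only [Function.comp, Equiv.subRight_apply]
    rw [show (n : ℤ) - (j - 1) = (n + 1 : ℕ) - j by push_cast; ring,
      show (m : ℤ) + (j - 1) = m + j - 1 by ring, ← add_assoc m n 1, qPoch_succ, ← pow_succ', e3,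
      ← e1, ← e2]
    linear_combination (-(qPoch (s ^ 2) (s ^ 2) (m + n) * (recipPoch (s ^ 2) ((n + 1 : ℕ) - j)) *
      ((1 - (s ^ 2) ^ ((m : ℤ) + j)) * recipPoch (s ^ 2) (m + j)))) * e4

/-- The finite form of the Jacobi triple product identity, equivalent to the `q`-binomial
theorem. -/
theorem hasSum_finite_tripleProduct {s x : ℂ} (hs0 : s ≠ 0) (hs : ‖s‖ < 1) (hx : x ≠ 0)
    (m n : ℕ) :
    HasSum (fun j : ℤ => x ^ j * s ^ (j ^ 2) * (qPoch (s ^ 2) (s ^ 2) (m + n) *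
      (recipPoch (s ^ 2) (n - j) * recipPoch (s ^ 2) (m + j))))
      (qPoch (-(s / x)) (s ^ 2) m * qPoch (-(x * s)) (s ^ 2) n) := by
  apply hasSum_finite_tripleProduct_aux hs0 hs hx
  have h0 : HasSum (fun j : ℤ => x⁻¹ ^ j * s ^ (j ^ 2) * (qPoch (s ^ 2) (s ^ 2) 0 *
      (recipPoch (s ^ 2) (-j) * recipPoch (s ^ 2) ((0 : ℕ) + j)))) 1 := by
    convert hasSum_single (f := fun j : ℤ => x⁻¹ ^ j * s ^ (j ^ 2) * (qPoch (s ^ 2) (s ^ 2) 0 *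
      (recipPoch (s ^ 2) (-j) * recipPoch (s ^ 2) ((0 : ℕ) + j)))) 0 ?_ using 1
    · simp [recipPoch_zero, qPoch_zero]
    · intro j hj
      rcases lt_or_gt_of_ne hj with h | h
      · rw [recipPoch_of_neg _ (i := ((0 : ℕ) : ℤ) + j) (by simpa using h)]; simp
      · rw [recipPoch_of_neg _ (i := -j) (by simpa using h)]; simp
  have h1 := hasSum_finite_tripleProduct_aux hs0 hs (inv_ne_zero hx) 0 m h0
  have h2 := (Equiv.neg ℤ).hasSum_iff.mpr h1
  convert h2 using 2 with j
  · simp [mul_comm]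
  · rw [one_mul]; congr 2; field_simp

theorem norm_sq_lt_one {s : ℂ} (hs : ‖s‖ < 1) : ‖s ^ 2‖ < 1 := by
  rw [norm_pow]; exact pow_lt_one₀ (norm_nonneg s) hs two_ne_zero

theorem summable_norm_theta {s x : ℂ} (hs0 : s ≠ 0) (hs : ‖s‖ < 1) (hx : x ≠ 0) :
    Summable fun j : ℤ => ‖x ^ j * s ^ (j ^ 2)‖ := by
  have key : ∀ y : ℂ, y ≠ 0 → Summable fun n : ℕ => ‖y ^ n * s ^ (n ^ 2)‖ := by
    intro y hy
    apply Summable.norm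
    refine summable_of_ratio_test_tendsto_lt_one zero_lt_one
      (Eventually.of_forall fun n => by positivity) ?_
    have h : Tendsto (fun n : ℕ => ‖y‖ * ‖s‖ * (‖s‖ ^ 2) ^ n) atTop (𝓝 (‖y‖ * ‖s‖ * 0)) :=
      (tendsto_pow_atTop_nhds_zero_of_lt_one (by positivity)
        (pow_lt_one₀ (norm_nonneg s) hs two_ne_zero)).const_mul _
    rw [mul_zero] at h
    refine h.congr fun n => ?_
    have h1 : ‖y‖ ≠ 0 := norm_ne_zero_iff.mpr hy
    have h2 : ‖s‖ ≠ 0 := norm_ne_zero_iff.mpr hs0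
    simp only [norm_mul, norm_pow]
    rw [eq_div_iff (by positivity)]
    ring
  refine Summable.of_nat_of_neg ((key x hx).congr fun n => ?_)
    ((key x⁻¹ (inv_ne_zero hx)).congr fun n => ?_)
  · rw [zpow_natCast, ← Nat.cast_pow, zpow_natCast]
  · rw [zpow_neg, zpow_natCast, neg_sq, ← Nat.cast_pow, zpow_natCast, inv_pow]

/-- The Jacobi triple product identity. -/
theorem hasSum_tripleProduct {s x : ℂ} (hs0 : s ≠ 0) (hs : ‖s‖ < 1) (hx : x ≠ 0) :
    HasSum (fun j : ℤ => x ^ j * s ^ (j ^ 2))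
      (qPochInf (s ^ 2) (s ^ 2) * qPochInf (-(x * s)) (s ^ 2) * qPochInf (-(s / x)) (s ^ 2)) := by
  have hp := norm_sq_lt_one hs
  have hsum := summable_norm_theta hs0 hs hx
  have hne := qPochInf_self_ne_zero hp
  suffices h : ∑' j : ℤ, x ^ j * s ^ (j ^ 2) =
      qPochInf (s ^ 2) (s ^ 2) * qPochInf (-(x * s)) (s ^ 2) * qPochInf (-(s / x)) (s ^ 2) by
    rw [← h]; exact hsum.of_norm.hasSum
  obtain ⟨C, hC, hCb⟩ := exists_norm_recipPoch_le hp
  obtain ⟨D, hD, hDb⟩ := exists_norm_le_of_tendsto (tendsto_qPoch (s ^ 2) (s ^ 2) hp)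
  have hdiag : Tendsto (fun n : ℕ => n + n) atTop atTop :=
    tendsto_atTop_mono (fun n => Nat.le_add_left n n) tendsto_id
  -- Let m = n → ∞ in the finite form; the theta series times a constant dominates.
  have hlim := tendsto_tsum_of_dominated_convergence (𝓕 := atTop)
    (f := fun (n : ℕ) (j : ℤ) => x ^ j * s ^ (j ^ 2) * (qPoch (s ^ 2) (s ^ 2) (n + n) *
      (recipPoch (s ^ 2) (n - j) * recipPoch (s ^ 2) (n + j))))
    (g := fun j : ℤ => x ^ j * s ^ (j ^ 2) * (qPochInf (s ^ 2) (s ^ 2) *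
      ((qPochInf (s ^ 2) (s ^ 2))⁻¹ * (qPochInf (s ^ 2) (s ^ 2))⁻¹)))
    (hsum.mul_right (D * (C * C)))
    (fun j => Tendsto.const_mul _ <| ((tendsto_qPoch _ _ hp).comp hdiag).mul <|
      (tendsto_recipPoch_comp hp <| by
        simpa [sub_eq_add_neg] using
          tendsto_atTop_add_const_right _ (-j) tendsto_natCast_atTop_atTop).mul
      (tendsto_recipPoch_comp hp <|
        tendsto_atTop_add_const_right _ j tendsto_natCast_atTop_atTop))
    (Eventually.of_forall fun n j => by
      rw [norm_mul, norm_mul (qPoch _ _ _), norm_mul (recipPoch _ _)]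
      gcongr
      · exact hDb _
      · exact hCb _
      · exact hCb _)
  simp only [(hasSum_finite_tripleProduct hs0 hs hx _ _).tsum_eq] at hlim
  have hlim2 := (tendsto_qPoch (-(s / x)) (s ^ 2) hp).mul (tendsto_qPoch (-(x * s)) (s ^ 2) hp)
  have := tendsto_nhds_unique hlim hlim2
  rw [tsum_mul_right] at this
  rw [mul_inv_cancel_left₀ hne, mul_inv_eq_iff_eq_mul₀ hne] at this
  rw [this]
  ring

/-! ### The quintuple product -/

theorem HasSum.congr_of_eq {ι : Type*} {f g : ι → ℂ} {a b : ℂ} (h : HasSum f a)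
    (hf : ∀ i, g i = f i) (hab : b = a) : HasSum g b := by
  rw [hab, funext hf]; exact h

theorem HasSum.mul_of_summable_norm {ι κ : Type*} {f : ι → ℂ} {g : κ → ℂ} {a b : ℂ}
    (hf : HasSum f a) (hg : HasSum g b) (hf' : Summable fun i => ‖f i‖)
    (hg' : Summable fun i => ‖g i‖) : HasSum (fun x : ι × κ => f x.1 * g x.2) (a * b) :=
  hf.mul hg (summable_mul_of_summable_norm hf' hg')

theorem HasSum.int_mod_three {F : ℤ → ℂ} {a : ℂ} (h : HasSum F a) :
    HasSum (fun k : ℤ => F (3 * k) + F (3 * k + 1) + F (3 * k + 2)) a := by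
  have h1 := (Int.divModEquiv 3).symm.hasSum_iff.mpr h
  refine h1.prod_fiberwise fun k => ?_
  convert hasSum_fintype (fun i : Fin 3 => (F ∘ (Int.divModEquiv 3).symm) (k, i)) using 1
  simp [Fin.sum_univ_three, Int.divModEquiv, mul_comm, add_comm]

theorem qPochInf_trisection {y : ℂ} (hy : ‖y‖ < 1) :
    qPochInf y y = qPochInf y (y ^ 3) * qPochInf (y ^ 2) (y ^ 3) * qPochInf (y ^ 3) (y ^ 3) := by
  have hy3 : ‖y ^ 3‖ < 1 := by rw [norm_pow]; exact pow_lt_one₀ (norm_nonneg y) hy three_ne_zero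
  have h : ∀ n, qPoch y y (3 * n) =
      qPoch y (y ^ 3) n * qPoch (y ^ 2) (y ^ 3) n * qPoch (y ^ 3) (y ^ 3) n := by
    intro n
    induction n with
    | zero => simp [qPoch_zero]
    | succ n ih =>
      rw [show 3 * (n + 1) = 3 * n + 1 + 1 + 1 by ring]
      simp only [qPoch_succ, ih]
      ring
  have h3 : Tendsto (fun n : ℕ => 3 * n) atTop atTop :=
    tendsto_atTop_mono (fun n => Nat.le_mul_of_pos_left n three_pos) tendsto_id
  refine tendsto_nhds_unique ((tendsto_qPoch y y hy).comp h3) ?_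
  simp only [Function.comp_def, h]
  exact ((tendsto_qPoch _ _ hy3).mul (tendsto_qPoch _ _ hy3)).mul (tendsto_qPoch _ _ hy3)

/-- Euler's pentagonal number theorem. -/
theorem hasSum_pentagonal {s : ℂ} (hs0 : s ≠ 0) (hs : ‖s‖ < 1) :
    HasSum (fun n : ℤ => (-1) ^ n * s ^ (3 * n ^ 2 + n)) (qPochInf (s ^ 2) (s ^ 2)) := by
  have hs3 : ‖s ^ 3‖ < 1 := by rw [norm_pow]; exact pow_lt_one₀ (norm_nonneg s) hs three_ne_zero
  -- With base s³ and x = -s, the three factors are the residue classes modulo 3 of (s²;s²)_∞.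
  convert hasSum_tripleProduct (x := -s) (pow_ne_zero 3 hs0) hs3 (neg_ne_zero.mpr hs0) using 1
  · funext n
    rw [show (-s) ^ n = (-1) ^ n * s ^ n by rw [← mul_zpow]; simp, mul_assoc, ← zpow_natCast s 3,
      ← zpow_mul, ← zpow_add₀ hs0]
    congr 2; push_cast; ring
  · rw [qPochInf_trisection (norm_sq_lt_one hs), show -(-s * s ^ 3) = (s ^ 2) ^ 2 by ring,
      show (s ^ 3) ^ 2 = (s ^ 2) ^ 3 by ring, show -(s ^ 3 / -s) = s ^ 2 by field_simp]
    ring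

theorem neg_one_zpow_add (n k : ℤ) : (-1 : ℂ) ^ (n + k) = (-1) ^ n * (-1) ^ k :=
  zpow_add₀ (by norm_num) n k

/-- In the product of two theta series behind the quintuple product, this is the coefficient of
z^(3k). The shift n ↦ n + k makes it a multiple of the pentagonal series; for z^(3k+1) the
reflection n ↦ k - n does the same. -/
theorem hasSum_shifted_pentagonal_zero {s P : ℂ} (hs0 : s ≠ 0)
    (hP : HasSum (fun n : ℤ => (-1) ^ n * s ^ (6 * n ^ 2 + 2 * n)) P) (k : ℤ) :
    HasSum (fun n : ℤ => (-1) ^ n *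
      s ^ (6 * n ^ 2 - 4 * (3 * k) * n + (3 * k) ^ 2 - 3 * k + 2 * n))
      ((-1) ^ k * s ^ (3 * k ^ 2 - k) * P) := by
  rw [← (Equiv.addRight k).hasSum_iff]
  refine (hP.mul_left ((-1) ^ k * s ^ (3 * k ^ 2 - k))).congr_of_eq (fun n => ?_) rfl
  rw [Function.comp_apply, Equiv.coe_addRight, neg_one_zpow_add,
    show 6 * (n + k) ^ 2 - 4 * (3 * k) * (n + k) + (3 * k) ^ 2 - 3 * k + 2 * (n + k) =
      3 * k ^ 2 - k + (6 * n ^ 2 + 2 * n) by ring, zpow_add₀ hs0]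
  ring

theorem hasSum_shifted_pentagonal_one {s P : ℂ} (hs0 : s ≠ 0)
    (hP : HasSum (fun n : ℤ => (-1) ^ n * s ^ (6 * n ^ 2 + 2 * n)) P) (k : ℤ) :
    HasSum (fun n : ℤ => (-1) ^ n * s ^ (6 * n ^ 2 - 4 * (3 * k + 1) * n + (3 * k + 1) ^ 2 -
      (3 * k + 1) + 2 * n)) ((-1) ^ k * s ^ (3 * k ^ 2 + k) * P) := by
  rw [← (Equiv.subLeft k).hasSum_iff]
  refine (hP.mul_left ((-1) ^ k * s ^ (3 * k ^ 2 + k))).congr_of_eq (fun n => ?_) rfl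
  rw [Function.comp_apply, Equiv.subLeft_apply, sub_eq_add_neg, neg_one_zpow_add,
    show 6 * (k + -n) ^ 2 - 4 * (3 * k + 1) * (k + -n) + (3 * k + 1) ^ 2 - (3 * k + 1) +
      2 * (k + -n) = 3 * k ^ 2 + k + (6 * n ^ 2 + 2 * n) by ring, zpow_add₀ hs0, zpow_neg,
    ← inv_zpow]
  norm_num
  ring

/-- The reflection n ↦ 2k + 1 - n fixes the exponent and flips the sign. -/
theorem shifted_pentagonal_two_eq_zero {s a : ℂ} (k : ℤ)
    (h : HasSum (fun n : ℤ => (-1) ^ n * s ^ (6 * n ^ 2 - 4 * (3 * k + 2) * n + (3 * k + 2) ^ 2 -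
      (3 * k + 2) + 2 * n)) a) : a = 0 := by
  have h' := ((Equiv.subLeft (2 * k + 1)).hasSum_iff.mpr h).neg
  suffices a = -a by linear_combination this / 2
  refine h.unique ?_
  refine h'.congr_of_eq (fun n => ?_) rfl
  rw [Function.comp_apply, Equiv.subLeft_apply, sub_eq_add_neg (2 * k + 1) n, neg_one_zpow_add,
    zpow_neg, ← inv_zpow, neg_one_zpow_add, zpow_mul]
  rw [show 6 * (2 * k + 1 + -n) ^ 2 - 4 * (3 * k + 2) * (2 * k + 1 + -n) + (3 * k + 2) ^ 2 -
      (3 * k + 2) + 2 * (2 * k + 1 + -n) = 6 * n ^ 2 - 4 * (3 * k + 2) * n + (3 * k + 2) ^ 2 -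
      (3 * k + 2) + 2 * n by ring]
  norm_num

theorem theta_mul_theta_term {s z : ℂ} (hs0 : s ≠ 0) (hz : z ≠ 0) (N n : ℤ) :
    (z / s) ^ (N - 2 * n) * s ^ ((N - 2 * n) ^ 2) * ((-z ^ 2) ^ n * (s ^ 2) ^ (n ^ 2)) =
      z ^ N * ((-1) ^ n * s ^ (6 * n ^ 2 - 4 * N * n + N ^ 2 - N + 2 * n)) := by
  rw [div_zpow, neg_eq_neg_one_mul (z ^ 2), mul_zpow, ← zpow_natCast z 2, ← zpow_natCast s 2,
    ← zpow_mul, ← zpow_mul, div_eq_mul_inv, ← zpow_neg]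
  have h1 : z ^ N = z ^ (N - 2 * n) * z ^ (((2 : ℕ) : ℤ) * n) := by
    rw [← zpow_add₀ hz]; congr 1; push_cast; ring
  have h2 : s ^ (6 * n ^ 2 - 4 * N * n + N ^ 2 - N + 2 * n) =
      s ^ (-(N - 2 * n)) * s ^ ((N - 2 * n) ^ 2) * s ^ (((2 : ℕ) : ℤ) * n ^ 2) := by
    rw [← zpow_add₀ hs0, ← zpow_add₀ hs0]; congr 1; push_cast; ring
  rw [h1, h2]
  ring

/-- The bijection `(N, n) ↦ (N - 2 n, n)`. -/
def shearEquiv : ℤ × ℤ ≃ ℤ × ℤ where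
  toFun a := (a.1 - 2 * a.2, a.2)
  invFun a := (a.1 + 2 * a.2, a.2)
  left_inv a := by simp
  right_inv a := by simp

theorem theta_mul_theta_value {s z : ℂ} (hs0 : s ≠ 0) (hz : z ≠ 0) :
    qPochInf (s ^ 2) (s ^ 2) * qPochInf (-(z / s * s)) (s ^ 2) *
      qPochInf (-(s / (z / s))) (s ^ 2) * (qPochInf ((s ^ 2) ^ 2) ((s ^ 2) ^ 2) *
      qPochInf (-(-z ^ 2 * s ^ 2)) ((s ^ 2) ^ 2) * qPochInf (-(s ^ 2 / -z ^ 2)) ((s ^ 2) ^ 2)) =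
      qPochInf ((s ^ 2) ^ 2) ((s ^ 2) ^ 2) * quintQ (s ^ 2) z := by
  have h1 : s / (z / s) = s ^ 2 / z := by field_simp
  have h2 : -(s ^ 2 / -z ^ 2) = s ^ 2 / z ^ 2 := by field_simp
  have h3 : -(-z ^ 2 * s ^ 2) = z ^ 2 * s ^ 2 := by ring
  rw [quintQ, div_mul_cancel₀ z hs0, h1, h2, h3]
  generalize qPochInf (s ^ 2) (s ^ 2) = a, qPochInf (-z) (s ^ 2) = b,
    qPochInf (-(s ^ 2 / z)) (s ^ 2) = c
  ring

/-- The quintuple product identity. -/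
theorem hasSum_quintQ {s z : ℂ} (hs0 : s ≠ 0) (hs : ‖s‖ < 1) (hz : z ≠ 0) :
    HasSum (fun k : ℤ => (-1) ^ k * (z ^ (3 * k) * s ^ (3 * k ^ 2 - k) +
      z ^ (3 * k + 1) * s ^ (3 * k ^ 2 + k))) (quintQ (s ^ 2) z) := by
  have hs2 := norm_sq_lt_one hs
  have hs20 : s ^ 2 ≠ 0 := pow_ne_zero 2 hs0
  have hx1 : z / s ≠ 0 := div_ne_zero hz hs0
  have hx2 : -z ^ 2 ≠ 0 := neg_ne_zero.mpr (pow_ne_zero 2 hz)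
  have hP := hasSum_pentagonal hs20 hs2
  have hPne := qPochInf_self_ne_zero (norm_sq_lt_one hs2)
  have hprod := (hasSum_tripleProduct hs0 hs hx1).mul_of_summable_norm
    (hasSum_tripleProduct hs20 hs2 hx2) (summable_norm_theta hs0 hs hx1)
    (summable_norm_theta hs20 hs2 hx2)
  rw [theta_mul_theta_value hs0 hz] at hprod
  generalize qPochInf ((s ^ 2) ^ 2) ((s ^ 2) ^ 2) = P at hP hPne hprod
  -- Collect the double series by the total exponent N of z.
  have hN := (shearEquiv.hasSum_iff.mpr hprod).prod_fiberwise fun N =>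
    ((shearEquiv.hasSum_iff.mpr hprod).summable.prod_factor N).hasSum
  simp only [Function.comp, shearEquiv, Equiv.coe_fn_mk, theta_mul_theta_term hs0 hz,
    tsum_mul_left] at hN
  have hP' : HasSum (fun n : ℤ => (-1) ^ n * s ^ (6 * n ^ 2 + 2 * n)) P := by
    refine hP.congr_of_eq (fun n => ?_) rfl
    rw [← zpow_natCast s 2, ← zpow_mul]; congr 2; push_cast; ring
  have h2 : ∀ k : ℤ, ∑' n : ℤ, (-1) ^ n * s ^ (6 * n ^ 2 - 4 * (3 * k + 2) * n +
      (3 * k + 2) ^ 2 - (3 * k + 2) + 2 * n) = 0 := by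
    intro k
    by_cases h : Summable fun n : ℤ => (-1) ^ n * s ^ (6 * n ^ 2 - 4 * (3 * k + 2) * n +
      (3 * k + 2) ^ 2 - (3 * k + 2) + 2 * n)
    · exact shifted_pentagonal_two_eq_zero k h.hasSum
    -- The default value of `tsum` is the wanted one, so summability need not be proved.
    · exact tsum_eq_zero_of_not_summable h
  have h3 := hN.int_mod_three.mul_left P⁻¹
  rw [inv_mul_cancel_left₀ hPne] at h3
  refine h3.congr_of_eq (fun k => ?_) rfl
  rw [(hasSum_shifted_pentagonal_zero hs0 hP' k).tsum_eq,
    (hasSum_shifted_pentagonal_one hs0 hP' k).tsum_eq, h2]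
  field_simp
  ring

/-! ### Bailey pairs relative to `a = p` -/

/-- `(A, β)` is a Bailey pair relative to `a = p`, where `A_r = (1 - p) α_r`:
`β_n = ∑_{r ≤ n} A_r / ((p; p)_{n-r} (p; p)_{n+r+1})`. -/
def IsBaileyPair (p : ℂ) (A β : ℕ → ℂ) : Prop :=
  ∀ n : ℕ, HasSum (fun r : ℕ => A r * (recipPoch p (n - r) * recipPoch p (n + r + 1))) (β n)

/-- The map `β ↦ β'` of the limiting case of Bailey's lemma. -/
noncomputable def baileyStep (p : ℂ) (β : ℕ → ℂ) (n : ℕ) : ℂ :=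
  ∑ s ∈ Finset.range (n + 1), p ^ (s * (s + 1)) * β s * recipPoch p (n - s)

/-- Terms with s < r vanish; s = r + t leaves the Vandermonde sum with m = n - r and b = 2r + 1. -/
theorem sum_baileyKernel {p : ℂ} (hp : ‖p‖ < 1) (n r : ℕ) :
    ∑ s ∈ Finset.range (n + 1), p ^ (s * (s + 1)) * recipPoch p (n - s) *
      (recipPoch p (s - r) * recipPoch p (s + r + 1)) =
      p ^ (r * (r + 1)) * (recipPoch p (n - r) * recipPoch p (n + r + 1)) := by
  rcases lt_or_ge n r with h | h
  · rw [recipPoch_of_neg p (i := (n : ℤ) - r) (by lia), zero_mul, mul_zero]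
    refine Finset.sum_eq_zero fun s hs => ?_
    rw [Finset.mem_range] at hs
    rw [recipPoch_of_neg p (i := (s : ℤ) - r) (by lia)]
    ring
  · obtain ⟨m, rfl⟩ := Nat.exists_eq_add_of_le h
    rw [add_assoc r m 1, Finset.sum_range_add, Finset.sum_eq_zero (fun s hs => by
      rw [Finset.mem_range] at hs
      rw [recipPoch_of_neg p (i := (s : ℤ) - r) (by lia)]
      ring), zero_add]
    rw [show ((r + m : ℕ) : ℤ) - r = m by push_cast; ring,
      show ((r + m : ℕ) : ℤ) + r + 1 = m + (2 * r + 1 : ℕ) by push_cast; ring,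
      ← sum_recipPoch_vandermonde hp m (2 * r + 1), Finset.mul_sum]
    refine Finset.sum_congr rfl fun t _ => ?_
    rw [show ((r + m : ℕ) : ℤ) - (r + t : ℕ) = m - t by push_cast; ring,
      show ((r + t : ℕ) : ℤ) - r = t by push_cast; ring,
      show ((r + t : ℕ) : ℤ) + r + 1 = t + (2 * r + 1 : ℕ) by push_cast; ring]
    ring

theorem IsBaileyPair.step {p : ℂ} (hp : ‖p‖ < 1) {A β : ℕ → ℂ} (h : IsBaileyPair p A β) :
    IsBaileyPair p (fun r => p ^ (r * (r + 1)) * A r) (baileyStep p β) := by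
  intro n
  have h1 := hasSum_sum (s := Finset.range (n + 1)) fun s _ =>
    (h s).mul_left (p ^ (s * (s + 1)) * recipPoch p (n - s))
  refine h1.congr_of_eq (fun r => ?_) (Finset.sum_congr rfl fun s _ => by ring)
  beta_reduce
  rw [mul_comm (p ^ (r * (r + 1))), mul_assoc, ← sum_baileyKernel hp, Finset.mul_sum]
  exact Finset.sum_congr rfl fun s _ => by ring

theorem IsBaileyPair.exists_norm_le {p : ℂ} (hp : ‖p‖ < 1) {A β : ℕ → ℂ}
    (h : IsBaileyPair p A β) (hA : Summable fun r => ‖A r‖) :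
    ∃ B : ℝ, 0 ≤ B ∧ ∀ n, ‖β n‖ ≤ B := by
  obtain ⟨C, hC, hCb⟩ := exists_norm_recipPoch_le hp
  refine ⟨∑' r, ‖A r‖ * (C * C), tsum_nonneg fun r => by positivity, fun n => ?_⟩
  rw [← (h n).tsum_eq]
  refine tsum_of_norm_bounded (hA.mul_right (C * C)).hasSum fun r => ?_
  rw [norm_mul, norm_mul (recipPoch _ _)]
  gcongr
  · exact hCb _
  · exact hCb _

theorem norm_pow_mul_succ_le {p : ℂ} (hp : ‖p‖ < 1) (r : ℕ) : ‖p ^ (r * (r + 1))‖ ≤ ‖p‖ ^ r := by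
  rw [norm_pow]
  exact pow_le_pow_of_le_one (norm_nonneg p) hp.le (Nat.le_mul_of_pos_right r r.succ_pos)

theorem summable_norm_pow_mul {p : ℂ} (hp : ‖p‖ < 1) {A : ℕ → ℂ} (hA : Summable fun r => ‖A r‖) :
    Summable fun r : ℕ => ‖p ^ (r * (r + 1)) * A r‖ := by
  refine hA.of_nonneg_of_le (fun r => norm_nonneg _) fun r => ?_
  rw [norm_mul]
  exact mul_le_of_le_one_left (norm_nonneg _)
    ((norm_pow_mul_succ_le hp r).trans (pow_le_one₀ (norm_nonneg p) hp.le))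

/-- The limiting case of Bailey's lemma. -/
theorem IsBaileyPair.hasSum {p : ℂ} (hp : ‖p‖ < 1) {A β : ℕ → ℂ}
    (h : IsBaileyPair p A β) (hA : Summable fun r => ‖A r‖) :
    HasSum (fun n : ℕ => p ^ (n * (n + 1)) * β n)
      ((∑' r : ℕ, p ^ (r * (r + 1)) * A r) / qPochInf p p) := by
  obtain ⟨B, hB, hBb⟩ := h.exists_norm_le hp hA
  obtain ⟨C, hC, hCb⟩ := exists_norm_recipPoch_le hp
  have hne := qPochInf_self_ne_zero hp
  have hβ : Summable fun n : ℕ => ‖p ^ (n * (n + 1)) * β n‖ := by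
    refine ((summable_geometric_of_lt_one (norm_nonneg p) hp).mul_right B).of_nonneg_of_le
      (fun n => norm_nonneg _) fun n => ?_
    rw [norm_mul]
    gcongr
    · exact norm_pow_mul_succ_le hp n
    · exact hBb n
  have hA' := summable_norm_pow_mul hp hA
  have hsub : ∀ r : ℕ, Tendsto (fun n : ℕ => (n : ℤ) - r) atTop atTop := fun r => by
    simpa [sub_eq_add_neg] using
      tendsto_atTop_add_const_right _ (-(r : ℤ)) tendsto_natCast_atTop_atTop
  have hadd : ∀ r : ℕ, Tendsto (fun n : ℕ => (n : ℤ) + r + 1) atTop atTop := fun r =>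
    tendsto_atTop_add_const_right _ 1
      (tendsto_atTop_add_const_right _ (r : ℤ) tendsto_natCast_atTop_atTop)
  -- The limit of `baileyStep p β n` is computed twice: through the new pair, with factor (p;p)_∞⁻²,
  -- and from its definition, with factor (p;p)_∞⁻¹. Equating the two cancels one factor.
  have lim1 := tendsto_tsum_of_dominated_convergence (𝓕 := atTop)
    (f := fun (n : ℕ) (r : ℕ) => p ^ (r * (r + 1)) * A r *
      (recipPoch p (n - r) * recipPoch p (n + r + 1)))
    (hA'.mul_right (C * C))
    (fun r => Tendsto.const_mul _ <| (tendsto_recipPoch_comp hp (hsub r)).mul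
      (tendsto_recipPoch_comp hp (hadd r)))
    (Eventually.of_forall fun n r => by
      rw [norm_mul, norm_mul (recipPoch _ _)]
      gcongr
      · exact hCb _
      · exact hCb _)
  have lim2 := tendsto_tsum_of_dominated_convergence (𝓕 := atTop)
    (f := fun (n : ℕ) (s : ℕ) => p ^ (s * (s + 1)) * β s * recipPoch p (n - s))
    (hβ.mul_right C)
    (fun s => Tendsto.const_mul _ <| tendsto_recipPoch_comp hp (hsub s))
    (Eventually.of_forall fun n s => by
      rw [norm_mul]
      gcongr
      exact hCb _)
  have heq : ∀ n : ℕ, ∑' s : ℕ, p ^ (s * (s + 1)) * β s * recipPoch p (n - s) =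
      ∑' r : ℕ, p ^ (r * (r + 1)) * A r * (recipPoch p (n - r) * recipPoch p (n + r + 1)) := by
    intro n
    rw [(h.step hp n).tsum_eq, baileyStep]
    refine tsum_eq_sum fun s hs => ?_
    rw [Finset.mem_range] at hs
    rw [recipPoch_of_neg p (by lia), mul_zero]
  simp only [heq] at lim2
  have := tendsto_nhds_unique lim1 lim2
  rw [tsum_mul_right, tsum_mul_right, ← mul_assoc] at this
  have h2 := mul_right_cancel₀ (inv_ne_zero hne) this
  rw [← div_eq_mul_inv] at h2
  rw [h2]
  exact hβ.of_norm.hasSum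

/-! ### The multiple series -/

/-- The summand of the multiple series attached to a sequence `β`; the last summation index is
`n.1`, the others are `n.2`. -/
noncomputable def baileyTerm (p : ℂ) (β : ℕ → ℂ) (w : ℕ) (n : ℕ × (Fin w → ℕ)) : ℂ :=
  p ^ (∑ i, (tailSum n.2 i + n.1) * (tailSum n.2 i + n.1 + 1)) *
    (∏ i, recipPoch p (n.2 i)) * (p ^ (n.1 * (n.1 + 1)) * β n.1)

theorem tailSum_snoc_last {w : ℕ} (a : ℕ) (u : Fin w → ℕ) :
    tailSum (Fin.snoc u a : Fin (w + 1) → ℕ) (Fin.last w) = a := by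
  have : Finset.Ici (Fin.last w) = {Fin.last w} := by
    ext i; simp [Fin.last_le_iff]
  simp [tailSum, this]

theorem tailSum_snoc_castSucc {w : ℕ} (a : ℕ) (u : Fin w → ℕ) (i : Fin w) :
    tailSum (Fin.snoc u a : Fin (w + 1) → ℕ) i.castSucc = tailSum u i + a := by
  have h : ∀ (k : ℕ) (m : Fin k → ℕ) (i : Fin k),
      tailSum m i = ∑ j, if i ≤ j then m j else 0 := fun k m i => by
    rw [tailSum, ← Finset.sum_filter]
    congr 1; ext j; simp
  rw [h, h, Fin.sum_univ_castSucc]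
  simp [Fin.le_last]

theorem le_tailSum {w : ℕ} (u : Fin w → ℕ) (i : Fin w) : u i ≤ tailSum u i :=
  Finset.single_le_sum (fun _ _ => Nat.zero_le _) (Finset.mem_Ici.mpr le_rfl)

theorem summable_prod_pow {ρ : ℝ} (h0 : 0 ≤ ρ) (h1 : ρ < 1) (w : ℕ) :
    Summable fun u : Fin w → ℕ => ∏ i, ρ ^ u i := by
  induction w with
  | zero => exact (hasSum_fintype _).summable
  | succ w ih =>
    rw [← (Fin.snocEquiv fun _ => ℕ).summable_iff]
    refine ((summable_geometric_of_lt_one h0 h1).mul_of_nonneg ih (fun _ => by positivity)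
      fun _ => by positivity).congr fun x => ?_
    simp [Fin.prod_univ_castSucc, Fin.snocEquiv, mul_comm]

theorem summable_baileyTerm {p : ℂ} (hp : ‖p‖ < 1) {β : ℕ → ℂ} {B : ℝ} (hB : 0 ≤ B)
    (hβ : ∀ n, ‖β n‖ ≤ B) (w : ℕ) : Summable (baileyTerm p β w) := by
  obtain ⟨C, hC, hCb⟩ := exists_norm_recipPoch_le hp
  have hs := (((summable_geometric_of_lt_one (norm_nonneg p) hp).mul_right B).mul_of_nonneg
    ((summable_prod_pow (norm_nonneg p) hp w).mul_right (C ^ w)) (fun _ => by positivity)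
    fun _ => by positivity)
  refine Summable.of_norm_bounded hs fun n => ?_
  rw [baileyTerm, norm_mul, norm_mul, mul_comm]
  refine mul_le_mul ?_ (mul_le_mul ?_ ?_ (norm_nonneg _) (by positivity)) (by positivity)
    (by positivity)
  · rw [norm_mul]
    gcongr
    · exact norm_pow_mul_succ_le hp _
    · exact hβ _
  · rw [norm_pow, Finset.prod_pow_eq_pow_sum]
    refine pow_le_pow_of_le_one (norm_nonneg p) hp.le (Finset.sum_le_sum fun i _ => ?_)
    exact ((le_tailSum n.2 i).trans (Nat.le_add_right _ _)).trans
      (Nat.le_mul_of_pos_right _ (Nat.succ_pos _))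
  · rw [norm_prod]
    refine (Finset.prod_le_prod (fun _ _ => norm_nonneg _) fun i _ => hCb _).trans_eq ?_
    simp

/-- The terms with the same `n_{v-1} + n_v` grouped together. -/
def antidiagonalSigmaEquiv (U : Type*) :
    (Σ c : ℕ × U, Finset.HasAntidiagonal.antidiagonal c.1) ≃ ℕ × ℕ × U where
  toFun x := (x.2.1.2, x.2.1.1, x.1.2)
  invFun y := ⟨(y.2.1 + y.1, y.2.2), ⟨(y.2.1, y.1), by simp⟩⟩
  left_inv := by
    rintro ⟨⟨M, u⟩, ⟨⟨a, b⟩, h⟩⟩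
    obtain rfl : a + b = M := by simpa using h
    rfl
  right_inv _ := rfl

/-- The outer indices see the two innermost ones only through a + b, so summing with a + b fixed is
one Bailey step on β. -/
theorem baileyTerm_snoc (p : ℂ) (β : ℕ → ℂ) (w : ℕ) (a b : ℕ) (u : Fin w → ℕ) :
    baileyTerm p β (w + 1) (b, Fin.snoc u a) =
      p ^ (∑ i, (tailSum u i + (a + b)) * (tailSum u i + (a + b) + 1)) *
        (∏ i, recipPoch p (u i)) * (p ^ ((a + b) * (a + b + 1)) *
          (p ^ (b * (b + 1)) * β b * recipPoch p a)) := by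
  simp only [baileyTerm, Fin.sum_univ_castSucc, Fin.prod_univ_castSucc, tailSum_snoc_last,
    tailSum_snoc_castSucc, Fin.snoc_castSucc, Fin.snoc_last, pow_add, add_assoc]
  ring

theorem sum_baileyTerm_antidiagonal (p : ℂ) (β : ℕ → ℂ) (w M : ℕ) (u : Fin w → ℕ) :
    ∑ x ∈ Finset.HasAntidiagonal.antidiagonal M, baileyTerm p β (w + 1) (x.2, Fin.snoc u x.1) =
      baileyTerm p (baileyStep p β) w (M, u) := by
  rw [Finset.sum_congr rfl fun x hx => by
    rw [baileyTerm_snoc, Finset.HasAntidiagonal.mem_antidiagonal.mp hx], ← Finset.mul_sum, ← Finset.mul_sum,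
    baileyTerm, baileyStep, ← Finset.Nat.sum_antidiagonal_swap,
    Finset.Nat.sum_antidiagonal_eq_sum_range_succ_mk]
  congr 2
  refine Finset.sum_congr rfl fun s hs => ?_
  rw [Finset.mem_range] at hs
  simp only [Prod.fst_swap, Prod.snd_swap]
  rw [Nat.cast_sub (by lia)]

/-- The iterated Bailey lemma. -/
theorem IsBaileyPair.hasSum_baileyTerm {p : ℂ} (hp : ‖p‖ < 1) (w : ℕ) {A β : ℕ → ℂ}
    (h : IsBaileyPair p A β) (hA : Summable fun r => ‖A r‖) :
    HasSum (baileyTerm p β w) ((∑' r : ℕ, p ^ ((w + 1) * (r * (r + 1))) * A r) / qPochInf p p) := by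
  induction w generalizing A β with
  | zero =>
    rw [← (Equiv.prodUnique ℕ (Fin 0 → ℕ)).symm.hasSum_iff]
    refine (h.hasSum hp hA).congr_of_eq (fun n => ?_) (by simp)
    simp [baileyTerm]
  | succ w ih =>
    obtain ⟨B, hB, hBb⟩ := h.exists_norm_le hp hA
    -- The recursion absorbs the innermost index: one index fewer, with the stepped pair in place of
    -- (A, β).
    have h1 := ih (h.step hp) (summable_norm_pow_mul hp hA)
    have hsum := summable_baileyTerm hp hB hBb (w + 1)
    let e := (antidiagonalSigmaEquiv (Fin w → ℕ)).trans
      ((Equiv.refl ℕ).prodCongr (Fin.snocEquiv fun _ => ℕ))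
    rw [← e.hasSum_iff]
    refine HasSum.sigma_of_hasSum (h1.congr_of_eq (fun _ => rfl) ?_) ?_ (e.summable_iff.mpr hsum)
    · congr 2
      funext r
      ring
    · rintro ⟨M, u⟩
      rw [← sum_baileyTerm_antidiagonal, ← Finset.sum_coe_sort]
      exact hasSum_fintype _

/-! ### The Bailey pair -/

/-- The conditions on a and b make a(1 + ζ⁻¹t) + b(1 + ζt) = 1 for all t, which removes the surplus
factor in the Bailey pair. -/
theorem exists_sixth_root_coeffs : ∃ ζ a b : ℂ, ζ ≠ 0 ∧ ζ + ζ⁻¹ = 1 ∧ a + b = 1 ∧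
    a * ζ⁻¹ + b * ζ = 0 := by
  obtain ⟨y, hy⟩ := IsAlgClosed.exists_pow_nat_eq (-3 : ℂ) two_pos
  obtain ⟨ζ, hζ⟩ : ∃ ζ : ℂ, ζ = (1 + y) / 2 := ⟨_, rfl⟩
  have h : ζ ^ 2 = ζ - 1 := by rw [hζ]; linear_combination hy / 4
  have h0 : ζ ≠ 0 := by rintro rfl; norm_num at h
  have h2 : 2 - ζ ≠ 0 := fun h' => by
    rw [← sub_eq_zero.mp h'] at h; norm_num at h
  refine ⟨ζ, -(ζ ^ 2 / (2 - ζ)), 1 / (2 - ζ), h0, ?_, ?_, ?_⟩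
  · field_simp; linear_combination h
  · field_simp; linear_combination -h
  · field_simp; ring

/-- The coefficients `a ζ^j + b ζ^(-j)`. -/
noncomputable def sexticCoeff (ζ a b : ℂ) (j : ℤ) : ℂ := a * ζ ^ j + b * ζ⁻¹ ^ j

section SexticCoeff

variable {ζ a b : ℂ}

theorem cube_eq_neg_one_of_add_inv (h0 : ζ ≠ 0) (h : ζ + ζ⁻¹ = 1) : ζ ^ 3 = -1 := by
  field_simp at h
  linear_combination (ζ + 1) * h

theorem sexticCoeff_three_mul_add (h0 : ζ ≠ 0) (h : ζ + ζ⁻¹ = 1) (k i : ℤ) :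
    sexticCoeff ζ a b (3 * k + i) = (-1) ^ k * sexticCoeff ζ a b i := by
  have h3 := cube_eq_neg_one_of_add_inv h0 h
  have h3' : ζ⁻¹ ^ 3 = -1 := by rw [inv_pow, h3]; norm_num
  have e : ∀ y : ℂ, y ≠ 0 → y ^ 3 = -1 → y ^ (3 * k + i) = (-1) ^ k * y ^ i := fun y hy hy3 => by
    rw [zpow_add₀ hy, zpow_mul, show (3 : ℤ) = (3 : ℕ) by rfl, zpow_natCast, hy3]
  rw [sexticCoeff, e ζ h0 h3, e ζ⁻¹ (inv_ne_zero h0) h3', sexticCoeff]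
  ring

theorem sexticCoeff_zero (hab : a + b = 1) : sexticCoeff ζ a b 0 = 1 := by
  simpa [sexticCoeff] using hab

theorem sexticCoeff_one (h : ζ + ζ⁻¹ = 1) (hab : a + b = 1) (hab' : a * ζ⁻¹ + b * ζ = 0) :
    sexticCoeff ζ a b 1 = 1 := by
  rw [sexticCoeff, zpow_one, zpow_one]
  linear_combination (a + b) * h + hab - hab'

theorem sexticCoeff_two (h0 : ζ ≠ 0) (h : ζ + ζ⁻¹ = 1)
    (hab' : a * ζ⁻¹ + b * ζ = 0) : sexticCoeff ζ a b 2 = 0 := by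
  rw [sexticCoeff, show (2 : ℤ) = (2 : ℕ) by rfl, zpow_natCast, zpow_natCast]
  have h1 : ζ * ζ⁻¹ = 1 := mul_inv_cancel₀ h0
  linear_combination (a * ζ + b * ζ⁻¹ + a + b) * h - hab' - (a + b) * h1

theorem summable_sexticCoeff_mul {s x : ℂ} (hs0 : s ≠ 0) (hs : ‖s‖ < 1) (hx : x ≠ 0)
    (h0 : ζ ≠ 0) : Summable fun j : ℤ => sexticCoeff ζ a b j * (x ^ j * s ^ (j ^ 2)) := by
  refine (((summable_norm_theta hs0 hs (mul_ne_zero h0 hx)).of_norm.mul_left a).add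
    ((summable_norm_theta hs0 hs (mul_ne_zero (inv_ne_zero h0) hx)).of_norm.mul_left b)).congr
    fun j => ?_
  rw [sexticCoeff, mul_zpow, mul_zpow]
  ring

end SexticCoeff

theorem qPoch_mul_qPoch_sixth_root {q ζ : ℂ} (hq : ‖q‖ < 1) (h0 : ζ ≠ 0) (h : ζ + ζ⁻¹ = 1)
    (n : ℕ) : qPoch (-(q / ζ)) (q ^ 2) n * qPoch (-(ζ * q)) (q ^ 2) n =
      qPoch (q ^ 3) (q ^ 6) n / qPoch q (q ^ 2) n := by
  have hne : ∀ k : ℕ, 1 - q * (q ^ 2) ^ k ≠ 0 := fun k => by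
    rw [← pow_mul, ← pow_succ']; exact one_sub_pow_ne_zero hq (Nat.succ_ne_zero _)
  have hne' : qPoch q (q ^ 2) n ≠ 0 := Finset.prod_ne_zero_iff.mpr fun k _ => hne k
  rw [eq_div_iff hne', qPoch, qPoch, qPoch, qPoch,
    ← Finset.prod_mul_distrib, ← Finset.prod_mul_distrib]
  refine Finset.prod_congr rfl fun k _ => ?_
  have h1 : ζ * ζ⁻¹ = 1 := mul_inv_cancel₀ h0
  rw [show (q ^ 6) ^ k = ((q ^ 2) ^ k) ^ 3 by rw [← pow_mul, ← pow_mul, ← pow_mul]; ring_nf,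
    div_eq_mul_inv]
  generalize (q ^ 2) ^ k = y
  linear_combination (q * y) * (1 - q * y) * h + (q * y) ^ 2 * (1 - q * y) * h1

/-- The numerators `(1 - p) α_r` of the Bailey pair. -/
noncomputable def sexticNumerator (ζ a b q : ℂ) (r : ℕ) : ℂ :=
  sexticCoeff ζ a b r * q ^ ((r : ℤ) ^ 2) +
    sexticCoeff ζ a b (-((r : ℤ) + 1)) * q ^ ((-((r : ℤ) + 1)) ^ 2)

/-- The `β`-side of the Bailey pair. -/
noncomputable def sexticBeta (q : ℂ) (n : ℕ) : ℂ :=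
  qPoch (q ^ 3) (q ^ 6) n / qPoch q (q ^ 2) n / qPoch (q ^ 2) (q ^ 2) (2 * n + 1)

section Pair

variable {ζ a b q : ℂ}

/-- Lengths n + 1 and n make the kernel invariant under j ↦ -1 - j, so j = r and j = -r - 1 fold
into one term. The longer product has the surplus factor 1 + ζ^(∓1) q^(2n+1), which the weights a
and b cancel. -/
theorem isBaileyPair_sextic (hq0 : q ≠ 0) (hq : ‖q‖ < 1) (h0 : ζ ≠ 0) (h : ζ + ζ⁻¹ = 1)
    (hab : a + b = 1) (hab' : a * ζ⁻¹ + b * ζ = 0) :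
    IsBaileyPair (q ^ 2) (sexticNumerator ζ a b q) (sexticBeta q) := by
  intro n
  have hE := qPoch_self_ne_zero (norm_sq_lt_one hq) (2 * n + 1)
  have h1 := (hasSum_finite_tripleProduct hq0 hq h0 (n + 1) n).mul_left a
  have h2 := (hasSum_finite_tripleProduct hq0 hq (inv_ne_zero h0) (n + 1) n).mul_left b
  have h3 := ((h1.add h2).mul_left (qPoch (q ^ 2) (q ^ 2) (2 * n + 1))⁻¹).nat_add_neg_add_one
  refine h3.congr_of_eq (fun r => ?_) ?_
  · rw [show n + 1 + n = 2 * n + 1 by ring, sexticNumerator, sexticCoeff, sexticCoeff,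
      show (n : ℤ) - -((r : ℤ) + 1) = n + r + 1 by ring,
      show ((n + 1 : ℕ) : ℤ) + -((r : ℤ) + 1) = n - r by push_cast; ring,
      show ((n + 1 : ℕ) : ℤ) + r = n + r + 1 by push_cast; ring]
    field_simp
  · rw [sexticBeta, ← qPoch_mul_qPoch_sixth_root hq h0 h, div_inv_eq_mul,
      mul_comm q ζ, mul_comm ζ⁻¹ q, ← div_eq_mul_inv, qPoch_succ (-(q / ζ)),
      qPoch_succ (-(ζ * q)), div_eq_inv_mul]
    congr 1
    rw [div_eq_mul_inv q ζ]
    generalize qPoch (-(q * ζ⁻¹)) (q ^ 2) n = u, qPoch (-(ζ * q)) (q ^ 2) n = w,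
      (q ^ 2) ^ n = y
    linear_combination (-(u * w)) * hab - u * w * q * y * hab'

theorem summable_sexticNumerator (hq0 : q ≠ 0) (hq : ‖q‖ < 1) (h0 : ζ ≠ 0) :
    Summable fun r => ‖sexticNumerator ζ a b q r‖ := by
  have h := (summable_sexticCoeff_mul (a := a) (b := b) hq0 hq one_ne_zero
    h0).hasSum.nat_add_neg_add_one.summable.norm
  simpa only [one_zpow, one_mul, sexticNumerator] using h

/-- As r(r + 1) is invariant under r ↦ -r - 1, the sum unfolds to ℤ. The classes j = 3k, 3k + 1, 3k
+ 2 carry (-1)^k, (-1)^k, 0, matching the quintuple series with s = q^(6v+3), z = q^(4v+1). -/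
theorem tsum_sexticNumerator (hq0 : q ≠ 0) (hq : ‖q‖ < 1) (h0 : ζ ≠ 0) (h : ζ + ζ⁻¹ = 1)
    (hab : a + b = 1) (hab' : a * ζ⁻¹ + b * ζ = 0) (v : ℕ) :
    ∑' r : ℕ, (q ^ 2) ^ (v * (r * (r + 1))) * sexticNumerator ζ a b q r =
      quintQ (q ^ (12 * v + 6)) (q ^ (4 * v + 1)) := by
  have hs : ‖q ^ (6 * v + 3)‖ < 1 := by
    rw [norm_pow]; exact pow_lt_one₀ (norm_nonneg q) hq (by lia)
  have hs' : ‖q ^ (2 * v + 1)‖ < 1 := by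
    rw [norm_pow]; exact pow_lt_one₀ (norm_nonneg q) hq (by lia)
  have hQ := hasSum_quintQ (pow_ne_zero (6 * v + 3) hq0) hs (pow_ne_zero (4 * v + 1) hq0)
  rw [← pow_mul, show (6 * v + 3) * 2 = 12 * v + 6 by ring] at hQ
  have hsum := (summable_sexticCoeff_mul (a := a) (b := b) (pow_ne_zero (2 * v + 1) hq0) hs'
    (pow_ne_zero (2 * v) hq0) h0).hasSum
  have hterm : ∀ j : ℤ, (q ^ (2 * v)) ^ j * (q ^ (2 * v + 1)) ^ (j ^ 2) =
      q ^ (j ^ 2 + 2 * v * (j ^ 2 + j)) := fun j => by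
    rw [← zpow_natCast, ← zpow_natCast, ← zpow_mul, ← zpow_mul, ← zpow_add₀ hq0]
    congr 1; push_cast; ring
  simp only [hterm] at hsum
  have hmod := hsum.int_mod_three
  have hval := hmod.unique (hQ.congr_of_eq (fun k => ?_) rfl)
  · rw [hval] at hsum
    rw [← hsum.nat_add_neg_add_one.tsum_eq]
    refine tsum_congr fun r => ?_
    have e1 : q ^ ((r : ℤ) ^ 2 + 2 * v * ((r : ℤ) ^ 2 + r)) =
        (q ^ 2) ^ (v * (r * (r + 1))) * q ^ ((r : ℤ) ^ 2) := by
      rw [← pow_mul, ← zpow_natCast q, ← zpow_add₀ hq0]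
      congr 1; push_cast; ring
    have e2 : q ^ ((-((r : ℤ) + 1)) ^ 2 + 2 * v * ((-((r : ℤ) + 1)) ^ 2 + -((r : ℤ) + 1))) =
        (q ^ 2) ^ (v * (r * (r + 1))) * q ^ ((-((r : ℤ) + 1)) ^ 2) := by
      rw [← pow_mul, ← zpow_natCast q, ← zpow_add₀ hq0]
      congr 1; push_cast; ring
    rw [e1, e2, sexticNumerator]
    ring
  · have c0 := sexticCoeff_three_mul_add (a := a) (b := b) h0 h k 0
    rw [add_zero] at c0
    rw [c0, sexticCoeff_three_mul_add h0 h, sexticCoeff_three_mul_add h0 h,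
      sexticCoeff_zero hab, sexticCoeff_one h hab hab', sexticCoeff_two h0 h hab']
    simp only [← zpow_natCast q, ← zpow_mul, ← zpow_add₀ hq0]
    push_cast
    ring_nf

end Pair

/-! ### The hierarchy as a case of the iterated Bailey lemma -/

theorem hierarchyTerm_snoc (q : ℂ) (w : ℕ) (hv : 1 ≤ w + 1) (a : ℕ) (u : Fin w → ℕ) :
    hierarchyTerm q (w + 1) hv (Fin.snoc u a) = baileyTerm (q ^ 2) (sexticBeta q) w (a, u) := by
  have hlast : lastIdx (w + 1) hv = Fin.last w := rfl
  rw [hierarchyTerm, baileyTerm, hlast, Fin.Iio_last_eq_map, Finset.prod_map,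
    Fin.sum_univ_castSucc, sexticBeta]
  simp only [tailSum_snoc_last, tailSum_snoc_castSucc, Fin.coe_castSuccEmb, Fin.snoc_castSucc,
    Fin.snoc_last, recipPoch_natCast, pow_add, Finset.prod_inv_distrib]
  simp only [div_eq_mul_inv, mul_inv]
  ring

theorem mainTheorem11 (q : ℂ) (hq0 : q ≠ 0) (hq : ‖q‖ < 1) :
    (∀ (v : ℕ) (hv : 1 ≤ v),
      HasSum (fun n : Fin v → ℕ => hierarchyTerm q v hv n)
        (quintQ (q ^ (12 * v + 6)) (q ^ (4 * v + 1)) / qPochInf (q ^ 2) (q ^ 2))) ∧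
    HasSum
      (fun n : ℕ =>
        q ^ (2 * n * (n + 1)) / qPoch (q ^ 2) (q ^ 2) (2 * n + 1) *
          (qPoch (q ^ 3) (q ^ 6) n / qPoch q (q ^ 2) n))
      (quintQ (q ^ 18) (q ^ 5) / qPochInf (q ^ 2) (q ^ 2)) := by
  obtain ⟨ζ, a, b, h0, h, hab, hab'⟩ := exists_sixth_root_coeffs
  have hp := norm_sq_lt_one hq
  have hpair := isBaileyPair_sextic hq0 hq h0 h hab hab'
  have hsum := summable_sexticNumerator (a := a) (b := b) hq0 hq h0
  have hval := tsum_sexticNumerator hq0 hq h0 h hab hab'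
  refine ⟨fun v hv => ?_, ?_⟩
  · obtain ⟨w, rfl⟩ := Nat.exists_eq_add_of_le' hv
    rw [← hval, ← (Fin.snocEquiv fun _ => ℕ).hasSum_iff]
    exact (hpair.hasSum_baileyTerm hp w hsum).congr_of_eq
      (fun n => hierarchyTerm_snoc q w hv n.1 n.2) rfl
  · have h1 := hval 1
    -- The single series comes from the uniterated lemma, with no reindexing from `Fin 1 → ℕ`.
    simp only [one_mul] at h1
    norm_num at h1
    rw [← h1]
    refine (hpair.hasSum hp hsum).congr_of_eq (fun n => ?_) rfl
    rw [sexticBeta, ← pow_mul, mul_assoc]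
    ring
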